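/- Let $T>0$, $h>0$ and $c>0$ be fixed. For $m>0$ and $g>0$ put $K(\lambda,\mu)=\dfrac{4mg}{(\lambda-\mu)^2+(2mg)^2}$ and consider the Yang–Yang equation $$\varepsilon(\lambda)=\frac{\lambda^2}{2m}-h-\frac{T}{2\pi}\int_{-\infty}^{\infty}K(\lambda,\mu)\ln\left(1+e^{-\varepsilon(\mu)/T}\right)d\mu ,\qquad \lambda\in\mathbb R,$$ where a solution is a function $\varepsilon:\mathbb R\to\mathbb R$ for which the integrand is Lebesgue integrable for every $\lambda$ and the equation holds for every $\lambda$. In the small mass limit $m\to 0$, $g\to\infty$ with $2mg=c$ fixed, the solution satisfies $\varepsilon(\lambda)=\frac{\lambda^2}{2m}-h+O(\sqrt m)$, uniformly in $\lambda$. That is, there are constants $C>0$ and $m_0>0$, depending only on $T,h,c$, such that for all $m\in(0,m_0)$ and $g>0$ with $2mg=c$ the equation has a solution, and every solution $\varepsilon$ satisfies $$\left|\varepsilon(\lambda)-\left(\frac{\lambda^2}{2m}-h\right)\right|\le C\sqrt m\qquad\text{for all }\lambda\in\mathbb R .$$ -/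

import Mathlib

open MeasureTheory

/-- The Yang-Yang kernel `K(x, y) = 4 m g / ((x - y)² + (2 m g)²)`. -/
noncomputable def yangYangKernel (m g x y : ℝ) : ℝ :=
  4 * m * g / ((x - y) ^ 2 + (2 * m * g) ^ 2)

/-- `ε` solves the Yang-Yang equation with mass `m`, coupling constant `g`, temperature `T` and
chemical potential `h`: for every real `x` the integrand is Lebesgue integrable on `ℝ`, and
`ε(x) = x² / (2 m) - h - T / (2 π) ∫ K(x, y) ln (1 + exp (- ε(y) / T)) dy`. -/
structure IsYangYangSolution (m g T h : ℝ) (ε : ℝ → ℝ) : Prop where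
  integrable : ∀ x : ℝ, Integrable
    (fun y : ℝ => yangYangKernel m g x y * Real.log (1 + Real.exp (-(ε y / T)))) volume
  equation : ∀ x : ℝ, ε x = x ^ 2 / (2 * m) - h -
    T / (2 * Real.pi) *
      ∫ y : ℝ, yangYangKernel m g x y * Real.log (1 + Real.exp (-(ε y / T)))

open Filter Topology

/-! Write `ε = x²/(2m) - h - D`. The equation becomes `D = dressing D`, where the operator is
monotone and nonnegative, so the claim is `0 ≤ D ≤ C√m`.

Given a bound `D ≤ B - h` independent of `m`, the thermal factor is at most a constant times a
Gaussian of width of order `√m`; since the kernel is at most `2/c`, this gives the rate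
(`dressing_le_sqrt`).

The uniform bound comes from the fixed width of the kernel: a fixed share of its mass lies where
`y²/(2m) ≥ c²/(8m)`, which is large. If `D ≤ M`, this share lowers the bound on `dressing D` by a
fixed fraction of `M + h`, unless `M + h` exceeds `c²/(8m)` (`dressing_le_of_integrable`). Taking `M
= sup D` bounds the supremum, once it is known to be finite (`exists_forall_le_of_eq_dressing`). The
same estimate keeps the monotone iteration from `0` bounded, whence existence. -/

/-- The Cauchy kernel of total mass `2 π` and width `c`. -/
noncomputable def cauchyKernel (c x y : ℝ) : ℝ := 2 * c / ((x - y) ^ 2 + c ^ 2)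

/-- The integrand `ln (1 + exp (-ε / T))` at `y`, for `ε = y² / (2 m) - h - d`. -/
noncomputable def thermalLog (m T h d y : ℝ) : ℝ :=
  Real.log (1 + Real.exp ((d + h - y ^ 2 / (2 * m)) / T))

theorem yangYangKernel_eq_cauchyKernel {m g c : ℝ} (hc : 2 * m * g = c) (x y : ℝ) :
    yangYangKernel m g x y = cauchyKernel c x y := by
  unfold yangYangKernel cauchyKernel
  rw [← hc]
  ring

theorem cauchyKernel_pos {c : ℝ} (hc : 0 < c) (x y : ℝ) : 0 < cauchyKernel c x y := by
  unfold cauchyKernel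
  positivity

theorem continuous_cauchyKernel {c : ℝ} (hc : 0 < c) :
    Continuous fun p : ℝ × ℝ => cauchyKernel c p.1 p.2 := by
  unfold cauchyKernel
  refine Continuous.div (by fun_prop) (by fun_prop) fun p => ne_of_gt ?_
  positivity

theorem cauchyKernel_le {c : ℝ} (hc : 0 < c) (x y : ℝ) : cauchyKernel c x y ≤ 2 / c := by
  unfold cauchyKernel
  rw [div_le_div_iff₀ (by positivity) hc]
  nlinarith [mul_nonneg hc.le (sq_nonneg (x - y))]

theorem inv_le_cauchyKernel {c : ℝ} (hc : 0 < c) {x y : ℝ} (hxy : (x - y) ^ 2 ≤ c ^ 2) :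
    1 / c ≤ cauchyKernel c x y := by
  unfold cauchyKernel
  rw [div_le_div_iff₀ hc (by positivity)]
  nlinarith

/-- A Harnack inequality for the Cauchy kernel. -/
theorem cauchyKernel_le_mul {c : ℝ} (hc : 0 < c) (x y : ℝ) :
    cauchyKernel c x y ≤ (2 + 2 * x ^ 2 / c ^ 2) * cauchyKernel c 0 y := by
  unfold cauchyKernel
  have e : (2 + 2 * x ^ 2 / c ^ 2) * (2 * c / ((0 - y) ^ 2 + c ^ 2)) =
      2 * c * (2 * c ^ 2 + 2 * x ^ 2) / (c ^ 2 * (y ^ 2 + c ^ 2)) := by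
    have : y ^ 2 + c ^ 2 ≠ 0 := by positivity
    rw [zero_sub, neg_sq]
    field_simp
  have key : c ^ 2 * (y ^ 2 + c ^ 2) ≤ (2 * c ^ 2 + 2 * x ^ 2) * ((x - y) ^ 2 + c ^ 2) := by
    nlinarith [mul_nonneg (sq_nonneg c) (sq_nonneg (2 * x - y)),
      mul_nonneg (sq_nonneg x) (sq_nonneg (x - y)), sq_nonneg (c ^ 2)]
  rw [e, div_le_div_iff₀ (by positivity) (by positivity)]
  linarith [mul_le_mul_of_nonneg_left key (by positivity : 0 ≤ 2 * c)]

theorem cauchyKernel_eq_inv_one_add_sq {c : ℝ} (hc : 0 < c) (x y : ℝ) :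
    cauchyKernel c x y = 2 / c * (1 + ((y - x) / c) ^ 2)⁻¹ := by
  unfold cauchyKernel
  have h1 : (x - y) ^ 2 + c ^ 2 ≠ 0 := by positivity
  have h2 : 1 + ((y - x) / c) ^ 2 ≠ 0 := by positivity
  field_simp
  ring

theorem integrable_cauchyKernel {c : ℝ} (hc : 0 < c) (x : ℝ) :
    Integrable (cauchyKernel c x) := by
  have e : cauchyKernel c x = fun y => 2 / c * (1 + ((y - x) / c) ^ 2)⁻¹ :=
    funext (cauchyKernel_eq_inv_one_add_sq hc x)
  rw [e]
  exact ((integrable_inv_one_add_sq.comp_div hc.ne').comp_sub_right x).const_mul _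

theorem integral_cauchyKernel {c : ℝ} (hc : 0 < c) (x : ℝ) :
    ∫ y, cauchyKernel c x y = 2 * Real.pi := by
  simp_rw [cauchyKernel_eq_inv_one_add_sq hc x]
  rw [integral_const_mul, integral_sub_right_eq_self (fun y => (1 + (y / c) ^ 2)⁻¹) x,
    Measure.integral_comp_div (fun y => (1 + y ^ 2)⁻¹) c, integral_univ_inv_one_add_sq,
    abs_of_pos hc, smul_eq_mul]
  field_simp

theorem integrable_cauchyKernel_mul {c : ℝ} (hc : 0 < c) (x : ℝ) {f : ℝ → ℝ} (hf : Measurable f)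
    {M : ℝ} (hM : ∀ y, |f y| ≤ M) : Integrable fun y => cauchyKernel c x y * f y :=
  (integrable_cauchyKernel hc x).mul_bdd hf.aestronglyMeasurable
    (Eventually.of_forall fun y => by simpa using hM y)

/-- Moving from `x` away from the origin by between `c/2` and `c` gives an interval of length `c/2`
on which the kernel is at least `1/c` and `y² ≥ c²/4`. -/
theorem half_min_le_integral_cauchyKernel_mul {c m B : ℝ} (hc : 0 < c) (hm : 0 < m) (hB : 0 ≤ B)
    (x : ℝ) : min B (c ^ 2 / (8 * m)) / 2 ≤
      ∫ y, cauchyKernel c x y * min B (y ^ 2 / (2 * m)) := by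
  set b := min B (c ^ 2 / (8 * m)) with hb
  have hb0 : 0 ≤ b := le_min hB (by positivity)
  have hmin : ∀ y : ℝ, 0 ≤ min B (y ^ 2 / (2 * m)) := fun y => le_min hB (by positivity)
  have hint : Integrable fun y => cauchyKernel c x y * min B (y ^ 2 / (2 * m)) := by
    refine integrable_cauchyKernel_mul hc x (M := B) (by fun_prop) fun y => ?_
    rw [abs_of_nonneg (hmin y)]
    exact min_le_left _ _
  obtain ⟨a, hxa, hya⟩ : ∃ a : ℝ, (∀ y ∈ Set.Icc a (a + c / 2), (x - y) ^ 2 ≤ c ^ 2) ∧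
      ∀ y ∈ Set.Icc a (a + c / 2), (c / 2) ^ 2 ≤ y ^ 2 := by
    rcases le_total 0 x with hx | hx
    · refine ⟨x + c / 2, fun y hy => ?_, fun y hy => ?_⟩ <;> obtain ⟨h1, h2⟩ := hy <;> nlinarith
    · refine ⟨x - c, fun y hy => ?_, fun y hy => ?_⟩ <;> obtain ⟨h1, h2⟩ := hy <;> nlinarith
  calc b / 2 = ∫ y in Set.Icc a (a + c / 2), 1 / c * b := by
        rw [setIntegral_const, measureReal_def, Real.volume_Icc, add_sub_cancel_left,
          ENNReal.toReal_ofReal (by positivity), smul_eq_mul]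
        field_simp
    _ ≤ ∫ y in Set.Icc a (a + c / 2), cauchyKernel c x y * min B (y ^ 2 / (2 * m)) := by
        refine setIntegral_mono_on
          (integrableOn_const measure_Icc_lt_top.ne) hint.integrableOn measurableSet_Icc fun y hy => ?_
        refine mul_le_mul (inv_le_cauchyKernel hc (hxa y hy)) ?_ hb0 (cauchyKernel_pos hc x y).le
        refine min_le_min le_rfl ?_
        rw [div_le_div_iff₀ (by positivity) (by positivity)]
        nlinarith [hya y hy]
    _ ≤ _ := setIntegral_le_integral hint
        (Eventually.of_forall fun y => mul_nonneg (cauchyKernel_pos hc x y).le (hmin y))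

/-! ### Bounds on the thermal factor -/

theorem thermalLog_nonneg (m T h d y : ℝ) : 0 ≤ thermalLog m T h d y :=
  Real.log_nonneg (by linarith [Real.exp_pos ((d + h - y ^ 2 / (2 * m)) / T)])

theorem continuous_thermalLog (m T h : ℝ) :
    Continuous fun p : ℝ × ℝ => thermalLog m T h p.1 p.2 := by
  unfold thermalLog
  exact Continuous.log (by fun_prop) fun p => by positivity

theorem Measurable.thermalLog {D : ℝ → ℝ} (hD : Measurable D) (m T h : ℝ) :
    Measurable fun y => thermalLog m T h (D y) y :=
  (continuous_thermalLog m T h).measurable.comp (hD.prodMk measurable_id)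

theorem thermalLog_mono {T : ℝ} (hT : 0 < T) (m h y : ℝ) {d e : ℝ} (hde : d ≤ e) :
    thermalLog m T h d y ≤ thermalLog m T h e y := by
  unfold thermalLog
  gcongr

theorem thermalLog_le_exp (m T h d y : ℝ) :
    thermalLog m T h d y ≤ Real.exp ((d + h - y ^ 2 / (2 * m)) / T) := by
  have := Real.log_le_sub_one_of_pos
    (show 0 < 1 + Real.exp ((d + h - y ^ 2 / (2 * m)) / T) by positivity)
  unfold thermalLog
  linarith

/-- This is `ln(1 + e^(z/T)) ≤ max(0, z)/T + ln 2`, with `max(0, z)` written as `d + h` minus a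
minimum so that the gain can be integrated against the kernel. -/
theorem mul_thermalLog_le {T : ℝ} (hT : 0 < T) (m h d y : ℝ) :
    T * thermalLog m T h d y ≤ d + h + T * Real.log 2 - min (d + h) (y ^ 2 / (2 * m)) := by
  set z := d + h - y ^ 2 / (2 * m) with hz
  have hmax : d + h - min (d + h) (y ^ 2 / (2 * m)) = max 0 z := by
    rcases le_total (d + h) (y ^ 2 / (2 * m)) with h1 | h1
    · rw [min_eq_left h1, max_eq_left (by linarith)]; ring
    · rw [min_eq_right h1, max_eq_right (by linarith)]
  have hlog : thermalLog m T h d y ≤ max 0 z / T + Real.log 2 := by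
    have h1 : 1 + Real.exp (z / T) ≤ Real.exp (max 0 z / T) * 2 := by
      have h2 : (1 : ℝ) ≤ Real.exp (max 0 z / T) :=
        Real.one_le_exp (div_nonneg (le_max_left _ _) hT.le)
      have h3 : Real.exp (z / T) ≤ Real.exp (max 0 z / T) := by
        gcongr
        exact le_max_right _ _
      linarith
    calc thermalLog m T h d y ≤ Real.log (Real.exp (max 0 z / T) * 2) :=
          Real.log_le_log (by positivity) h1
      _ = _ := by rw [Real.log_mul (by positivity) (by norm_num), Real.log_exp]
  have h4 := mul_le_mul_of_nonneg_left hlog hT.le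
  have h5 : T * (max 0 z / T + Real.log 2) = max 0 z + T * Real.log 2 := by field_simp
  linarith

theorem abs_thermalLog_le {m T h d y M : ℝ} (hm : 0 < m) (hT : 0 < T) (hd : d ≤ M) :
    |thermalLog m T h d y| ≤ Real.exp ((M + h) / T) := by
  rw [abs_of_nonneg (thermalLog_nonneg ..)]
  refine (thermalLog_le_exp ..).trans (Real.exp_le_exp.2 ?_)
  have : 0 ≤ y ^ 2 / (2 * m) := by positivity
  gcongr
  linarith

/-! ### The dressing operator -/

/-- The integral term of the Yang-Yang equation for `ε(y) = y² / (2 m) - h - D(y)`. -/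
noncomputable def dressing (m T h c : ℝ) (D : ℝ → ℝ) (x : ℝ) : ℝ :=
  T / (2 * Real.pi) * ∫ y, cauchyKernel c x y * thermalLog m T h (D y) y

theorem dressing_nonneg {T c : ℝ} (hT : 0 < T) (hc : 0 < c) (m h : ℝ) (D : ℝ → ℝ) (x : ℝ) :
    0 ≤ dressing m T h c D x :=
  mul_nonneg (by positivity) (integral_nonneg fun y =>
    mul_nonneg (cauchyKernel_pos hc x y).le (thermalLog_nonneg ..))

theorem measurable_dressing {c : ℝ} (hc : 0 < c) (m T h : ℝ) {D : ℝ → ℝ} (hD : Measurable D) :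
    Measurable (dressing m T h c D) := by
  have h1 : StronglyMeasurable fun p : ℝ × ℝ =>
      cauchyKernel c p.1 p.2 * thermalLog m T h (D p.2) p.2 :=
    ((continuous_cauchyKernel hc).measurable.mul
      ((hD.thermalLog m T h).comp measurable_snd)).stronglyMeasurable
  exact h1.integral_prod_right.measurable.const_mul _

theorem integrable_cauchyKernel_mul_thermalLog {m T c M : ℝ} (hm : 0 < m) (hT : 0 < T)
    (hc : 0 < c) (h x : ℝ) {D : ℝ → ℝ} (hD : Measurable D) (hM : ∀ y, D y ≤ M) :
    Integrable fun y => cauchyKernel c x y * thermalLog m T h (D y) y :=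
  integrable_cauchyKernel_mul hc x (hD.thermalLog m T h) fun y => abs_thermalLog_le hm hT (hM y)

theorem dressing_mono {m T c M : ℝ} (hm : 0 < m) (hT : 0 < T) (hc : 0 < c) (h : ℝ)
    {D E : ℝ → ℝ} (hD : Measurable D) (hE : Measurable E) (hDE : D ≤ E) (hM : ∀ y, E y ≤ M) :
    dressing m T h c D ≤ dressing m T h c E := fun x =>
  mul_le_mul_of_nonneg_left
    (integral_mono
      (integrable_cauchyKernel_mul_thermalLog hm hT hc h x hD fun y => (hDE y).trans (hM y))
      (integrable_cauchyKernel_mul_thermalLog hm hT hc h x hE hM) fun y =>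
        mul_le_mul_of_nonneg_left (thermalLog_mono hT m h y (hDE y)) (cauchyKernel_pos hc x y).le)
    (by positivity)

/-- Integrability is assumed instead of measurability of `D`, so that the bound applies to an
arbitrary solution. -/
theorem dressing_le_of_integrable {m T h c M : ℝ} (hm : 0 < m) (hT : 0 < T) (hc : 0 < c)
    (hMh : 0 ≤ M + h) {D : ℝ → ℝ} {x : ℝ}
    (hint : Integrable fun y => cauchyKernel c x y * thermalLog m T h (D y) y)
    (hM : ∀ y, D y ≤ M) :
    dressing m T h c D x ≤
      M + h + T * Real.log 2 - min (M + h) (c ^ 2 / (8 * m)) / (4 * Real.pi) := by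
  have hmin : Integrable fun y => cauchyKernel c x y * min (M + h) (y ^ 2 / (2 * m)) := by
    refine integrable_cauchyKernel_mul hc x (M := M + h) (by fun_prop) fun y => ?_
    rw [abs_of_nonneg (le_min hMh (by positivity))]
    exact min_le_left _ _
  have hle : T * ∫ y, cauchyKernel c x y * thermalLog m T h (D y) y ≤
      2 * Real.pi * (M + h + T * Real.log 2) - min (M + h) (c ^ 2 / (8 * m)) / 2 := by
    calc T * ∫ y, cauchyKernel c x y * thermalLog m T h (D y) y
        = ∫ y, T * (cauchyKernel c x y * thermalLog m T h (D y) y) :=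
          (integral_const_mul _ _).symm
      _ ≤ ∫ y, (cauchyKernel c x y * (M + h + T * Real.log 2) -
            cauchyKernel c x y * min (M + h) (y ^ 2 / (2 * m))) := by
          refine integral_mono (hint.const_mul T)
            (((integrable_cauchyKernel hc x).mul_const _).sub hmin) fun y => ?_
          have h1 := (mul_le_mul_of_nonneg_left (thermalLog_mono hT m h y (hM y)) hT.le).trans
            (mul_thermalLog_le hT m h M y)
          have h2 := mul_le_mul_of_nonneg_left h1 (cauchyKernel_pos hc x y).le
          simp only
          linarith
      _ ≤ _ := by
          rw [integral_sub ((integrable_cauchyKernel hc x).mul_const _) hmin, integral_mul_const,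
            integral_cauchyKernel hc]
          linarith [half_min_le_integral_cauchyKernel_mul hc hm hMh x]
  have hpi := Real.pi_pos
  unfold dressing
  rw [div_mul_eq_mul_div, div_le_iff₀ (by positivity)]
  refine hle.trans (le_of_eq ?_)
  field_simp
  ring

theorem dressing_le_sqrt {m T h c M : ℝ} (hm : 0 < m) (hT : 0 < T) (hc : 0 < c) {D : ℝ → ℝ}
    {x : ℝ} (hint : Integrable fun y => cauchyKernel c x y * thermalLog m T h (D y) y)
    (hM : ∀ y, D y ≤ M) :
    dressing m T h c D x ≤
      T / (Real.pi * c) * Real.exp ((M + h) / T) * Real.sqrt (2 * Real.pi * T) * Real.sqrt m := by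
  have hb : 0 < 1 / (2 * m * T) := by positivity
  have hgauss : ∫ y : ℝ, Real.exp (-(1 / (2 * m * T)) * y ^ 2) =
      Real.sqrt (2 * Real.pi * T) * Real.sqrt m := by
    rw [integral_gaussian, ← Real.sqrt_mul (by positivity)]
    congr 1
    field_simp
  have hle : ∫ y, cauchyKernel c x y * thermalLog m T h (D y) y ≤
      2 / c * Real.exp ((M + h) / T) * (Real.sqrt (2 * Real.pi * T) * Real.sqrt m) := by
    rw [← hgauss, ← integral_const_mul]
    refine integral_mono hint ((integrable_exp_neg_mul_sq hb).const_mul _) fun y => ?_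
    have h1 : Real.exp ((M + h - y ^ 2 / (2 * m)) / T) =
        Real.exp ((M + h) / T) * Real.exp (-(1 / (2 * m * T)) * y ^ 2) := by
      rw [← Real.exp_add]
      congr 1
      field_simp
      ring
    have h2 := ((thermalLog_mono hT m h y (hM y)).trans (thermalLog_le_exp ..)).trans_eq h1
    refine (mul_le_mul (cauchyKernel_le hc x y) h2 (thermalLog_nonneg ..)
      (by positivity)).trans_eq ?_
    ring
  unfold dressing
  refine (mul_le_mul_of_nonneg_left hle (by positivity)).trans_eq ?_
  field_simp

/-! ### A priori bounds for arbitrary solutions -/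

/-- A fixed point of the dressing operator is bounded above. -/
theorem exists_forall_le_of_eq_dressing {m T h c : ℝ} (hm : 0 < m) (hT : 0 < T) (hc : 0 < c)
    {D : ℝ → ℝ}
    (hint : ∀ x, Integrable fun y => cauchyKernel c x y * thermalLog m T h (D y) y)
    (hfix : ∀ x, D x = dressing m T h c D x) : ∃ M, ∀ x, D x ≤ M := by
  -- Harnack under the integral gives quadratic growth, but with a coefficient that need not be
  -- below the `1/(2m)` of the parabola.
  have hgrowth : ∀ x, D x ≤ (2 + 2 * x ^ 2 / c ^ 2) * D 0 := by
    intro x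
    have h1 : ∫ y, cauchyKernel c x y * thermalLog m T h (D y) y ≤
        (2 + 2 * x ^ 2 / c ^ 2) * ∫ y, cauchyKernel c 0 y * thermalLog m T h (D y) y := by
      rw [← integral_const_mul]
      refine integral_mono (hint x) ((hint 0).const_mul _) fun y => ?_
      have h2 := mul_le_mul_of_nonneg_right (cauchyKernel_le_mul hc x y)
        (thermalLog_nonneg m T h (D y) y)
      simp only
      linarith
    rw [hfix x, hfix 0]
    unfold dressing
    refine (mul_le_mul_of_nonneg_left h1 (by positivity)).trans_eq ?_
    ring
  -- In fact `D = o(x²)`: after division by `1 + x²` the integrand tends to `0` pointwise and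
  -- Harnack dominates it. The filter covers both ends of the line.
  have hlittle : Tendsto (fun x => (1 + x ^ 2)⁻¹ * D x) (comap (fun x : ℝ => |x|) atTop) (𝓝 0) := by
    have hinv : Tendsto (fun x : ℝ => (1 + x ^ 2)⁻¹) (comap (fun x : ℝ => |x|) atTop) (𝓝 0) := by
      refine tendsto_inv_atTop_zero.comp (tendsto_atTop_mono (fun x => ?_)
        tendsto_comap)
      rw [← sq_abs x]
      nlinarith [sq_nonneg (|x| - 1), abs_nonneg x]
    have hlim : Tendsto (fun x => ∫ y, (1 + x ^ 2)⁻¹ *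
        (cauchyKernel c x y * thermalLog m T h (D y) y)) (comap (fun x : ℝ => |x|) atTop) (𝓝 (∫ _ : ℝ, (0 : ℝ))) := by
      refine tendsto_integral_filter_of_dominated_convergence
        (fun y => (2 + 2 / c ^ 2) * (cauchyKernel c 0 y * thermalLog m T h (D y) y))
        (Eventually.of_forall fun x => ((hint x).const_mul _).aestronglyMeasurable)
        (Eventually.of_forall fun x => Eventually.of_forall fun y => ?_)
        ((hint 0).const_mul _) (Eventually.of_forall fun y => ?_)
      · have hlog := thermalLog_nonneg m T h (D y) y
        have hK := cauchyKernel_pos hc x y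
        rw [Real.norm_of_nonneg (by positivity), inv_mul_le_iff₀ (by positivity)]
        have h2 := mul_le_mul_of_nonneg_right (cauchyKernel_le_mul hc x y) hlog
        have h3 : 2 + 2 * x ^ 2 / c ^ 2 ≤ (1 + x ^ 2) * (2 + 2 / c ^ 2) := by
          have h4 : (1 + x ^ 2) * (2 + 2 / c ^ 2) - (2 + 2 * x ^ 2 / c ^ 2) =
            2 * x ^ 2 + 2 / c ^ 2 := by ring
          have h5 : 0 ≤ 2 * x ^ 2 + 2 / c ^ 2 := by positivity
          linarith
        have h6 := mul_le_mul_of_nonneg_right h3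
          (mul_nonneg (cauchyKernel_pos hc 0 y).le hlog)
        linarith
      · have hlog := thermalLog_nonneg m T h (D y) y
        refine squeeze_zero (fun x => ?_) (fun x => ?_)
          (by simpa using hinv.mul_const (2 / c * thermalLog m T h (D y) y))
        · have hK := cauchyKernel_pos hc x y
          positivity
        · have hK := cauchyKernel_le hc x y
          gcongr
    have hmul := hlim.const_mul (T / (2 * Real.pi))
    simp only [integral_zero, mul_zero, integral_const_mul] at hmul
    refine hmul.congr fun x => ?_
    rw [hfix x]
    unfold dressing
    ring
  have hev : ∀ᶠ x in comap (fun x : ℝ => |x|) atTop, (1 + x ^ 2)⁻¹ * D x < 1 / (2 * m) :=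
    hlittle.eventually (gt_mem_nhds (by positivity))
  obtain ⟨R, -, hR⟩ := (atTop_basis.comap fun x : ℝ => |x|).mem_iff.1 hev
  have hD0 : 0 ≤ D 0 := (hfix 0).symm ▸ dressing_nonneg hT hc m h D 0
  set N := max (1 / (2 * m)) ((2 + 2 * R ^ 2 / c ^ 2) * D 0)
  -- The parabola absorbs `D` for `|x| ≥ R`, and `hgrowth` covers the rest; a bounded exponent then
  -- bounds the integral.
  have hN : ∀ x, D x + h - x ^ 2 / (2 * m) ≤ N + h := by
    intro x
    have hx : 0 ≤ x ^ 2 / (2 * m) := by positivity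
    rcases le_total R |x| with hRx | hRx
    · have h1 : (1 + x ^ 2)⁻¹ * D x < 1 / (2 * m) := hR hRx
      rw [inv_mul_lt_iff₀ (by positivity)] at h1
      have h2 : (1 + x ^ 2) * (1 / (2 * m)) = 1 / (2 * m) + x ^ 2 / (2 * m) := by ring
      linarith [le_max_left (1 / (2 * m)) ((2 + 2 * R ^ 2 / c ^ 2) * D 0)]
    · have h1 : x ^ 2 ≤ R ^ 2 := sq_le_sq.2 (hRx.trans (le_abs_self R))
      have h2 : (2 + 2 * x ^ 2 / c ^ 2) * D 0 ≤ (2 + 2 * R ^ 2 / c ^ 2) * D 0 := by gcongr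
      linarith [hgrowth x, le_max_right (1 / (2 * m)) ((2 + 2 * R ^ 2 / c ^ 2) * D 0)]
  refine ⟨T * Real.exp ((N + h) / T), fun x => ?_⟩
  have hle : ∫ y, cauchyKernel c x y * thermalLog m T h (D y) y ≤
      2 * Real.pi * Real.exp ((N + h) / T) := by
    rw [← integral_cauchyKernel hc x, ← integral_mul_const]
    refine integral_mono (hint x) ((integrable_cauchyKernel hc x).mul_const _) fun y => ?_
    refine mul_le_mul_of_nonneg_left ((thermalLog_le_exp ..).trans ?_) (cauchyKernel_pos hc x y).le
    gcongr
    exact hN y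
  rw [hfix x]
  unfold dressing
  refine (mul_le_mul_of_nonneg_left hle (by positivity)).trans_eq ?_
  field_simp

/-- For small mass, a fixed point of the dressing operator is bounded uniformly in the mass. -/
theorem add_le_of_eq_dressing {m T h c B : ℝ} (hm : 0 < m) (hT : 0 < T) (hh : 0 ≤ h) (hc : 0 < c)
    (hB : B = 4 * Real.pi * (h + T * Real.log 2)) (hBc : B < c ^ 2 / (8 * m)) {D : ℝ → ℝ}
    (hint : ∀ x, Integrable fun y => cauchyKernel c x y * thermalLog m T h (D y) y)
    (hfix : ∀ x, D x = dressing m T h c D x) (x : ℝ) : D x ≤ B - h := by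
  obtain ⟨M', hM'⟩ := exists_forall_le_of_eq_dressing hm hT hc hint hfix
  have hbdd : BddAbove (Set.range D) := ⟨M', by rintro _ ⟨y, rfl⟩; exact hM' y⟩
  have hM : ∀ y, D y ≤ ⨆ y, D y := le_ciSup hbdd
  set M := ⨆ y, D y
  have hM0 : 0 ≤ M := (dressing_nonneg hT hc m h D 0).trans ((hfix 0).symm.trans_le (hM 0))
  have hsup : M ≤ M + h + T * Real.log 2 - min (M + h) (c ^ 2 / (8 * m)) / (4 * Real.pi) :=
    ciSup_le fun y => (hfix y).trans_le
      (dressing_le_of_integrable hm hT hc (by linarith) (hint y) hM)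
  have hmin : min (M + h) (c ^ 2 / (8 * m)) ≤ B := by
    have h1 : min (M + h) (c ^ 2 / (8 * m)) / (4 * Real.pi) ≤ h + T * Real.log 2 := by linarith
    rw [div_le_iff₀ (by positivity)] at h1
    linarith
  -- Small mass rules out `c²/(8m) ≤ B`, leaving `M + h ≤ B`.
  have := (min_le_iff.1 hmin).resolve_right (not_le.2 hBc)
  linarith [hM x]

/-! ### Existence by monotone iteration -/

/-- If the dressing operator preserves the bound `M`, then it has a measurable fixed point. -/
theorem exists_eq_dressing {m T h c M : ℝ} (hm : 0 < m) (hT : 0 < T) (hc : 0 < c) (hM0 : 0 ≤ M)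
    (hM : ∀ D : ℝ → ℝ, Measurable D → (∀ y, D y ≤ M) → ∀ x, dressing m T h c D x ≤ M) :
    ∃ D : ℝ → ℝ, Measurable D ∧ (∀ y, D y ≤ M) ∧ ∀ x, D x = dressing m T h c D x := by
  set u : ℕ → ℝ → ℝ := fun n => (dressing m T h c)^[n] 0 with hu
  have hsucc : ∀ n, u (n + 1) = dressing m T h c (u n) := fun n =>
    Function.iterate_succ_apply' _ _ _
  have hmeas : ∀ n, Measurable (u n) := by
    intro n
    induction n with
    | zero => exact measurable_zero
    | succ n ih => rw [hsucc]; exact measurable_dressing hc m T h ih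
  have hle : ∀ n y, u n y ≤ M := by
    intro n
    induction n with
    | zero => exact fun _ => hM0
    | succ n ih => rw [hsucc]; exact hM _ (hmeas n) ih
  have hmono : Monotone u := by
    refine monotone_nat_of_le_succ fun n => ?_
    induction n with
    | zero => rw [hsucc]; exact fun x => dressing_nonneg hT hc m h _ x
    | succ n ih =>
      rw [hsucc (n + 1)]
      nth_rw 1 [hsucc n]
      exact dressing_mono hm hT hc h (hmeas n) (hmeas (n + 1)) ih (hle (n + 1))
  have hlim : ∀ x, Tendsto (fun n => u n x) atTop (𝓝 (⨆ n, u n x)) := fun x =>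
    tendsto_atTop_ciSup (fun _ _ hab => hmono hab x) ⟨M, by rintro _ ⟨n, rfl⟩; exact hle n x⟩
  refine ⟨fun x => ⨆ n, u n x, Measurable.iSup hmeas, fun x => ciSup_le fun n => hle n x,
    fun x => ?_⟩
  have hdress : Tendsto (fun n => dressing m T h c (u n) x) atTop
      (𝓝 (dressing m T h c (fun x => ⨆ n, u n x) x)) := by
    refine Tendsto.const_mul _ (tendsto_integral_of_dominated_convergence
      (fun y => cauchyKernel c x y * Real.exp ((M + h) / T))
      (fun n => (integrable_cauchyKernel_mul_thermalLog hm hT hc h x (hmeas n)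
        (hle n)).aestronglyMeasurable) ((integrable_cauchyKernel hc x).mul_const _)
      (fun n => Eventually.of_forall fun y => ?_) (Eventually.of_forall fun y => ?_))
    · rw [norm_mul, Real.norm_of_nonneg (cauchyKernel_pos hc x y).le]
      exact mul_le_mul_of_nonneg_left (abs_thermalLog_le hm hT (hle n y))
        (cauchyKernel_pos hc x y).le
    · exact (((continuous_thermalLog m T h).comp (Continuous.prodMk_left y)).tendsto _ |>.comp
        (hlim y)).const_mul _
  have hshift := (hlim x).comp (tendsto_add_atTop_nat 1)
  refine tendsto_nhds_unique hshift (hdress.congr fun n => ?_)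
  rw [Function.comp_apply, hsucc]

/-- The Yang-Yang equation is the fixed point equation of the dressing operator. -/
theorem isYangYangSolution_sub_iff {m g T h c : ℝ} (hmg : 2 * m * g = c) (D : ℝ → ℝ) :
    IsYangYangSolution m g T h (fun x => x ^ 2 / (2 * m) - h - D x) ↔
      (∀ x, Integrable fun y => cauchyKernel c x y * thermalLog m T h (D y) y) ∧
        ∀ x, D x = dressing m T h c D x := by
  have e : ∀ x y : ℝ, yangYangKernel m g x y *
      Real.log (1 + Real.exp (-((y ^ 2 / (2 * m) - h - D y) / T))) =
      cauchyKernel c x y * thermalLog m T h (D y) y := by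
    intro x y
    rw [yangYangKernel_eq_cauchyKernel hmg, thermalLog, ← neg_div]
    congr 5
    ring
  constructor
  · rintro ⟨h1, h2⟩
    simp only [e] at h1 h2
    exact ⟨h1, fun x => by unfold dressing; linarith [h2 x]⟩
  · rintro ⟨h1, h2⟩
    refine ⟨by simpa only [e] using h1, fun x => ?_⟩
    simp only [e]
    rw [h2 x]
    rfl

theorem mainTheorem8 (T h c : ℝ) (hT : 0 < T) (hh : 0 < h) (hc : 0 < c) :
    ∃ C m₀ : ℝ, 0 < C ∧ 0 < m₀ ∧
      ∀ m g : ℝ, 0 < m → m < m₀ → 0 < g → 2 * m * g = c →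
        (∃ ε : ℝ → ℝ, IsYangYangSolution m g T h ε) ∧
        ∀ ε : ℝ → ℝ, IsYangYangSolution m g T h ε →
          ∀ x : ℝ, |ε x - (x ^ 2 / (2 * m) - h)| ≤ C * Real.sqrt m := by

  set B := 4 * Real.pi * (h + T * Real.log 2) with hB
  have hlog : 0 < Real.log 2 := Real.log_pos (by norm_num)
  have hB0 : 0 < B := by positivity
  have hhB : h ≤ B := by
    have h1 : 0 < T * Real.log 2 := by positivity
    nlinarith [Real.pi_gt_three]
  -- `C` is the constant of `dressing_le_sqrt` at `M = B - h`; `m < c²/(8B)` says exactly `B <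
  -- c²/(8m)`.
  refine ⟨T / (Real.pi * c) * Real.exp ((B - h + h) / T) * Real.sqrt (2 * Real.pi * T),
    c ^ 2 / (8 * B), by positivity, by positivity, fun m g hm hm0 _ hmg => ?_⟩
  have hBc : B < c ^ 2 / (8 * m) := by
    rw [lt_div_iff₀ (by positivity)] at hm0 ⊢
    linarith
  constructor
  · obtain ⟨D, hD, hDM, hfix⟩ := exists_eq_dressing (h := h) (M := B - h) hm hT hc (by linarith)
      fun D hD hDM x => by
        have h1 := dressing_le_of_integrable hm hT hc (by linarith)
          (integrable_cauchyKernel_mul_thermalLog hm hT hc h x hD hDM) hDM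
        -- The bound reproduces itself: `B + T ln 2 - B/(4π) = B - h`.
        rw [sub_add_cancel, min_eq_left hBc.le, hB, mul_div_cancel_left₀ _ (by positivity)] at h1
        linarith
    exact ⟨_, (isYangYangSolution_sub_iff hmg D).2
      ⟨fun x => integrable_cauchyKernel_mul_thermalLog hm hT hc h x hD hDM, hfix⟩⟩
  · intro ε hε x
    obtain ⟨D, rfl⟩ : ∃ D : ℝ → ℝ, ε = fun x => x ^ 2 / (2 * m) - h - D x :=
      ⟨fun x => x ^ 2 / (2 * m) - h - ε x, by simp⟩
    obtain ⟨hint, hfix⟩ := (isYangYangSolution_sub_iff hmg D).1 hε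
    have hDM := add_le_of_eq_dressing hm hT hh.le hc hB hBc hint hfix
    have hx : x ^ 2 / (2 * m) - h - D x - (x ^ 2 / (2 * m) - h) = -D x := by ring
    simp only [hx, abs_neg]
    rw [hfix x, abs_of_nonneg (dressing_nonneg hT hc m h D x)]
    exact dressing_le_sqrt hm hT hc (hint x) hDM
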